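/- Let $G=(V,E)$ be a finite acyclic directed graph, multiple channels (edges) between two nodes being allowed, with source node $s$, and let $w$ be the information rate. Add $w$ imaginary channels $d_1,\dots,d_w$ with head $s$. For a node $v$ let $In(v)$ be the set of channels with head $v$, so that $d_1,\dots,d_w\in In(s)$. Let $\mathcal F$ be a finite field. In random linear network coding the local encoding coefficients $k_{d,e}$, for all pairs of a channel $e\in E$ and a channel $d\in In(tail(e))$, are independent and uniformly distributed random elements of $\mathcal F$. The global encoding kernels $f_e\in\mathcal F^w$ are determined by $f_{d_j}=$ the $j$-th standard basis vector for $1\le j\le w$, and $f_e=\sum_{d\in In(tail(e))}k_{d,e}f_d$ for $e\in E$. For a node $t$ put $F_t=(f_e:\ e\in In(t))$; the failure probability at $t$ is $P_{e_t}=Pr(\mathrm{Rank}(F_t)<w)$. Let $t$ be a sink node, and let $P_1,\dots,P_w$ be any collection of $w$ channel-disjoint directed paths from $s$ to $t$, each with at least one channel. Let $r$ be the number of their internal nodes (the nodes other than $s$ and $t$ lying on at least one of the paths), and let $i_1,\dots,i_r$ be these nodes in an ancestral topological order: with $i_0=s$, if $G$ has a directed path with at least one channel from $i_a$ to $i_b$,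 then $a<b$. Define the cuts successively: $CUT_{t,0}=\{d_1,\dots,d_w\}$, where $d_j$ is regarded as the channel preceding the first channel of $P_j$; and, for $0\le k\le r$, $CUT_{t,k+1}$ is obtained from $CUT_{t,k}$ by replacing each channel in $CUT_{t,k}\cap In(i_k)$ by the next channel on its path and keeping the other channels. Put $CUT_{t,k}^{out}=CUT_{t,k}\setminus In(i_k)$. Then $$P_{e_t}\leq 1-\prod_{k=0}^{r}\ \prod_{i=1}^{w-|CUT_{t,k}^{out}|}\left(1-\frac{1}{|\mathcal F|^{i}}\right).$$ -/

import Mathlib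

open MeasureTheory ProbabilityTheory

/-- A finite acyclic directed multigraph with node set `V`, channel set `E` and a
distinguished source node. -/
structure Network (V E : Type*) where
  tail : E → V
  head : E → V
  source : V
  acyclic : ∀ v : V, ¬ Relation.TransGen (fun a b => ∃ e, tail e = a ∧ head e = b) v v

/-- The `w` imaginary channels `d_1, …, d_w` entering the source, together with the channels
of the network. -/
abbrev Channel (E : Type*) (w : ℕ) := Fin w ⊕ E

namespace Network

variable {V E : Type*} (N : Network V E)

/-- `N.Adj a b`: some channel leads from `a` to `b`. -/
def Adj (a b : V) : Prop := ∃ e, N.tail e = a ∧ N.head e = b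

/-- `N.Ancestor a b`: there is a directed path with at least one channel from `a` to `b`. -/
def Ancestor (a b : V) : Prop := Relation.TransGen N.Adj a b

/-- Head of a channel; the imaginary channels enter the source. -/
def chHead {w : ℕ} : Channel E w → V
  | Sum.inl _ => N.source
  | Sum.inr e => N.head e

open Classical in
/-- `In(v)`, imaginary channels included if `v` is the source. -/
noncomputable def inChannels [Fintype E] (w : ℕ) (v : V) : Finset (Channel E w) :=
  Finset.univ.filter fun c => N.chHead c = v

/-- The adjacent pairs of channels `(d, e)`, that is, `d ∈ In(tail e)`. -/
abbrev LocalPair (w : ℕ) := {p : Channel E w × E // N.chHead p.1 = N.tail p.2}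

/-- A channel feeding directly into another one precedes it; this is well founded. -/
theorem feeds_wellFounded [Finite E] : WellFounded fun d e : E => N.head d = N.tail e := by
  have hT : WellFounded (Relation.TransGen fun d e : E => N.head d = N.tail e) := by
    have hlift : ∀ d e : E, Relation.TransGen (fun d e : E => N.head d = N.tail e) d e →
        Relation.TransGen (fun a b => ∃ e, N.tail e = a ∧ N.head e = b) (N.tail d) (N.tail e) := by
      intro d e h
      induction h with
      | single h => exact Relation.TransGen.single ⟨d, rfl, h⟩
      | tail _ h ih => exact ih.tail ⟨_, rfl, h⟩
    have : IsTrans E (Relation.TransGen fun d e : E => N.head d = N.tail e) :=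
      ⟨fun _ _ _ h₁ h₂ => h₁.trans h₂⟩
    have : Std.Irrefl (Relation.TransGen fun d e : E => N.head d = N.tail e) :=
      ⟨fun e h => N.acyclic _ (hlift e e h)⟩
    exact Finite.wellFounded_of_trans_of_irrefl _
  exact hT.mono fun _ _ h => Relation.TransGen.single h

section Coding

variable [Fintype E] {w : ℕ} {F : Type*} [Field F]

open Classical in
/-- Global encoding kernel of a channel of the network, by recursion along the acyclic network:
`f_e = ∑_{d ∈ In(tail e)} k_{d,e} f_d`, where the kernel of the imaginary channel `d_j` is the
`j`-th standard basis vector. -/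
noncomputable def edgeKernel (k : N.LocalPair w → F) : E → (Fin w → F) :=
  N.feeds_wellFounded.fix fun e ih =>
    ∑ d : {d : Channel E w // N.chHead d = N.tail e},
      k ⟨(d.1, e), d.2⟩ •
        (match d with
          | ⟨Sum.inl j, _⟩ => (Pi.single j 1 : Fin w → F)
          | ⟨Sum.inr d', h⟩ => ih d' h)

/-- Global encoding kernel `f_c` of an arbitrary channel. -/
noncomputable def kernel (k : N.LocalPair w → F) : Channel E w → (Fin w → F)
  | Sum.inl j => Pi.single j 1
  | Sum.inr e => N.edgeKernel k e

open Classical in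
/-- The recursion satisfied by the global encoding kernels. -/
theorem kernel_inr (k : N.LocalPair w → F) (e : E) :
    N.kernel k (Sum.inr e) =
      ∑ d : {d : Channel E w // N.chHead d = N.tail e},
        k ⟨(d.1, e), d.2⟩ • N.kernel k d.1 := by
  rw [kernel, edgeKernel, WellFounded.fix_eq]
  refine Finset.sum_congr rfl fun d _ => ?_
  rcases d with ⟨j | d', h⟩ <;> rfl

/-- The decoding matrix `F_t = (f_e : e ∈ In(t))`. -/
noncomputable def decodingMatrix (k : N.LocalPair w → F) (t : V) :
    Matrix (Fin w) (N.inChannels w t) F :=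
  Matrix.of fun a c => N.kernel k c.1 a

/-- Random linear network coding: the local encoding coefficients `k_{d,e}` are independent
random variables, each uniformly distributed on the finite field `F`. -/
structure IsRandomCoding [Fintype F] [MeasurableSpace F] {Ω : Type*} [MeasurableSpace Ω]
    (μ : Measure Ω) (K : N.LocalPair w → Ω → F) : Prop where
  measurable : ∀ p, Measurable (K p)
  indep : iIndepFun K μ
  uniform : ∀ p a, μ.real (K p ⁻¹' {a}) = 1 / (Fintype.card F : ℝ)

/-- The failure probability `P_{e_t} = Pr(Rank(F_t) < w)` at the node `t`. -/
noncomputable def failureProb {Ω : Type*} [MeasurableSpace Ω]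
    (μ : Measure Ω) (K : N.LocalPair w → Ω → F) (t : V) : ℝ :=
  μ.real {ω | (N.decodingMatrix (fun p => K p ω) t).rank < w}

end Coding

/-- A collection of `w` channel-disjoint directed paths from the source to `t`; each path is
the list of its channels. -/
structure DisjointPaths (w : ℕ) (t : V) where
  path : Fin w → List E
  nonempty : ∀ j, path j ≠ []
  tail_first : ∀ j, N.tail ((path j).head (nonempty j)) = N.source
  head_last : ∀ j, N.head ((path j).getLast (nonempty j)) = t
  consecutive : ∀ j, (path j).IsChain fun d e => N.head d = N.tail e
  disjoint : ∀ j j', j ≠ j' → (path j).Disjoint (path j')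

namespace DisjointPaths

variable {N} {w : ℕ} {t : V} (P : N.DisjointPaths w t)

/-- The internal nodes of the paths: the nodes on them other than the source and `t`. -/
def internalNodes : Set V :=
  {v | v ≠ N.source ∧ v ≠ t ∧ ∃ j, ∃ e ∈ P.path j, N.tail e = v ∨ N.head e = v}

/-- `i_0, i_1, …, i_r` is an ancestral (topological) order: `i_0` is the source, `i_1, …, i_r`
are the internal nodes of the paths listed once each, and whenever the network has a directed
path from `i_a` to `i_b`, then `a < b`. Values of `i` beyond `r` are irrelevant. -/
structure IsAncestralOrder (r : ℕ) (i : ℕ → V) : Prop where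
  source : i 0 = N.source
  injOn : Set.InjOn i (Set.Icc 1 r)
  image : i '' Set.Icc 1 r = P.internalNodes
  ancestral : ∀ a ≤ r, ∀ b ≤ r, N.Ancestor (i a) (i b) → a < b

/-- The `j`-th path preceded by the `j`-th imaginary channel: `chan j 0 = d_j`, and `chan j n`
is the `n`-th channel of the path (the default value past the end is never met by the cuts). -/
def chan (j : Fin w) (n : ℕ) : Channel E w :=
  (Sum.inl j :: (P.path j).map Sum.inr).getD n (Sum.inl j)

open Classical in
/-- Position, on the `j`-th path, of the channel that belongs to the `k`-th cut. Passing from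
the cut `k` to the cut `k + 1`, the channels entering `i_k` are replaced by their next channels
on the paths and the others remain. -/
noncomputable def cutPos (i : ℕ → V) : ℕ → Fin w → ℕ
  | 0, _ => 0
  | k + 1, j =>
      if N.chHead (P.chan j (cutPos i k j)) = i k then cutPos i k j + 1 else cutPos i k j

open Classical in
/-- The `k`-th cut `CUT_{t,k}`; in particular `CUT_{t,0}` is the set of imaginary channels. -/
noncomputable def cut (i : ℕ → V) (k : ℕ) : Finset (Channel E w) :=
  Finset.univ.image fun j => P.chan j (P.cutPos i k j)

open Classical in
/-- `CUT_{t,k}^{out} = CUT_{t,k} \ In(i_k)`. -/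
noncomputable def cutOut [Fintype E] (i : ℕ → V) (k : ℕ) : Finset (Channel E w) :=
  P.cut i k \ N.inChannels w (i k)

end DisjointPaths

end Network

/-! ### Counting matrices with nonzero determinant -/

section MatrixCounting

variable {F : Type*} [Field F] [Fintype F]

/-! Independent uniform coefficients make every coefficient vector equally likely, so the claim is a
count. Let `B_k` be the matrix of kernels on the `k`-th cut. `B_0` is the identity, and if `B_{r+1}`
is invertible then `t` decodes. It suffices that invertibility survives each step in the stated
proportion (`card_cutMatrix_succ`).

Let `m` channels of the `k`-th cut enter `i_k`. Adding an `m × m` matrix `M` to the coefficients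
between these channels and their successors leaves `B_k` fixed and adds to `B_{k+1}` the product of
`B_k` with `M` padded by zeros (`cutMatrix_succ_add_shift`). If `B_k` is invertible, factoring it
out leaves a block triangular matrix with an identity block and a block `C + M`, so the new cut is
invertible whenever `C + M` is. This holds for `|GL_m(F)| = q^(m²) ∏ (1 - q⁻ʰ)` choices of `M`,
where `q = |F|` and `1 ≤ h ≤ m`. Since shifts are translations of the coefficient space, double
counting (`Finset.mul_card_le_of_translate`) replaces any conditioning. -/

theorem card_det_ne_zero_eq_card_GL [DecidableEq F] (n : ℕ) :
    (Finset.univ.filter fun A : Matrix (Fin n) (Fin n) F => A.det ≠ 0).card =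
      Nat.card (GL (Fin n) F) := by
  rw [← Fintype.card_subtype, ← Nat.card_eq_fintype_card]
  refine Nat.card_congr (Equiv.symm ?_)
  refine
    { toFun := fun g => ⟨g.1, ?_⟩
      invFun := fun A => Matrix.GeneralLinearGroup.mkOfDetNeZero A.1 A.2
      left_inv := fun g => by ext; rfl
      right_inv := fun A => by ext; rfl }
  exact ((Matrix.isUnit_iff_isUnit_det _).1 g.isUnit).ne_zero

/-- Each factor is `q^n (1 - q^(-(n-i)))`; reversing the product puts `h = n - i`. -/
theorem prod_card_pow_sub_eq (n : ℕ) :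
    ((∏ i : Fin n, (Fintype.card F ^ n - Fintype.card F ^ (i : ℕ)) : ℕ) : ℝ) =
      (∏ h ∈ Finset.Icc 1 n, (1 - 1 / (Fintype.card F : ℝ) ^ h)) *
        (Fintype.card F : ℝ) ^ (n * n) := by
  have hq : (Fintype.card F : ℝ) ≠ 0 := by exact_mod_cast Fintype.card_ne_zero
  have hpos : 0 < Fintype.card F := Fintype.card_pos
  have hpow : ((Fintype.card F : ℝ) ^ n) ^ n = ∏ _j ∈ Finset.range n, (Fintype.card F : ℝ) ^ n := by
    simp
  rw [Nat.cast_prod, Fin.prod_univ_eq_prod_range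
    (fun i => ((Fintype.card F ^ n - Fintype.card F ^ i : ℕ) : ℝ)) n, pow_mul,
    ← Finset.prod_range_reflect, ← Finset.Ico_add_one_right_eq_Icc,
    Finset.prod_Ico_eq_prod_range, Nat.add_sub_cancel, hpow, ← Finset.prod_mul_distrib]
  refine Finset.prod_congr rfl fun j hj => ?_
  have hj' := Finset.mem_range.1 hj
  rw [Nat.cast_sub (Nat.pow_le_pow_right hpos (by omega))]
  have hn : (Fintype.card F : ℝ) ^ n = (Fintype.card F : ℝ) ^ (n - 1 - j) *
      (Fintype.card F : ℝ) ^ (1 + j) := by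
    rw [← pow_add]; congr 1; omega
  push_cast
  rw [hn]
  field_simp

/-- The number of square matrices `A` with `C + A` invertible. -/
theorem card_det_add_ne_zero {J : Type*} [Fintype J] [DecidableEq J] [DecidableEq F]
    (C : Matrix J J F) :
    ((Finset.univ.filter fun A : Matrix J J F => (C + A).det ≠ 0).card : ℝ) =
      (∏ h ∈ Finset.Icc 1 (Fintype.card J), (1 - 1 / (Fintype.card F : ℝ) ^ h)) *
        (Fintype.card F : ℝ) ^ (Fintype.card J * Fintype.card J) := by
  rw [← prod_card_pow_sub_eq, ← Nat.card_eq_fintype_card (α := F)]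
  norm_cast
  rw [Nat.card_eq_fintype_card, ← Matrix.card_GL_field, ← card_det_ne_zero_eq_card_GL]
  -- Translation by `C` is a bijection, so the count does not depend on `C`.
  let φ : Matrix J J F ≃ Matrix (Fin (Fintype.card J)) (Fin (Fintype.card J)) F :=
    (Equiv.addLeft C).trans (Matrix.reindex (Fintype.equivFin J) (Fintype.equivFin J))
  refine Finset.card_bij' (fun A _ => φ A) (fun A _ => φ.symm A) ?_ ?_ ?_ ?_
  · intro A hA
    simpa [φ] using hA
  · intro A hA
    have h : (φ (φ.symm A)).det ≠ 0 := by simpa using hA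
    simpa [φ] using h
  · simp
  · simp

end MatrixCounting

/-! ### Uniform independent coefficients -/

/-- Independent uniform variables: the probability of an event is its relative frequency. -/
theorem measureReal_eq_card_div {ι F Ω : Type*} [Fintype ι] [DecidableEq ι] [Fintype F]
    [MeasurableSpace F] [MeasurableSingletonClass F] [MeasurableSpace Ω]
    (μ : Measure Ω) [IsProbabilityMeasure μ]
    (K : ι → Ω → F) (hm : ∀ p, Measurable (K p)) (hind : iIndepFun K μ)
    (hu : ∀ p a, μ.real (K p ⁻¹' {a}) = 1 / (Fintype.card F : ℝ)) (S : Finset (ι → F)) :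
    μ.real {ω | (fun p => K p ω) ∈ S} = S.card / (Fintype.card (ι → F) : ℝ) := by
  have hpt : ∀ κ : ι → F, μ.real {ω | (fun p => K p ω) = κ} = 1 / (Fintype.card (ι → F) : ℝ) := by
    intro κ
    have h := hind.measure_inter_preimage_eq_mul Finset.univ (sets := fun p => {κ p})
      (fun p _ => measurableSet_singleton _)
    have h' : {ω | (fun p => K p ω) = κ} = ⋂ p ∈ Finset.univ, K p ⁻¹' {κ p} := by
      ext ω; simp [funext_iff]
    rw [h', Measure.real, h, ENNReal.toReal_prod]
    simp only [Measure.real] at hu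
    simp [hu]
  have hunion : {ω | (fun p => K p ω) ∈ S} = ⋃ κ ∈ S, {ω | (fun p => K p ω) = κ} := by
    ext ω; simp
  rw [hunion, measureReal_biUnion_finset]
  · simp [hpt, div_eq_mul_inv]
  · intro κ _ κ' _ hne
    rw [Function.onFun, Set.disjoint_left]
    rintro ω rfl h
    exact hne h
  · intro κ _
    have : {ω | (fun p => K p ω) = κ} = ⋂ p, K p ⁻¹' {κ p} := by
      ext ω; simp [funext_iff]
    rw [this]
    exact MeasurableSet.iInter fun p => hm p (measurableSet_singleton _)

namespace Network

variable {V E : Type*} (N : Network V E)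

/-! ### Locality of the global encoding kernels -/

/-- The kernel of a channel depends only on the coefficients at the tails of the channels
upstream of it. -/
theorem edgeKernel_congr [Fintype E] {w : ℕ} {F : Type*} [Field F] {κ κ' : N.LocalPair w → F}
    {v : V} (hκ : ∀ p : N.LocalPair w, N.tail p.1.2 ≠ v → κ p = κ' p) (e : E)
    (he : ¬ Relation.ReflTransGen N.Adj v (N.tail e)) :
    N.kernel κ (Sum.inr e) = N.kernel κ' (Sum.inr e) := by
  induction e using N.feeds_wellFounded.induction with
  | _ e ih =>
    rw [kernel_inr, kernel_inr]
    refine Finset.sum_congr rfl fun d _ => ?_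
    rw [hκ ⟨(d.1, e), d.2⟩ fun h => he (h ▸ Relation.ReflTransGen.refl)]
    rcases d with ⟨j | d, hd⟩
    · rfl
    · simp only
      rw [ih d hd fun h => he (h.tail ⟨d, rfl, hd⟩)]

/-- By acyclicity, no channel entering `v` lies downstream of `v`. -/
theorem kernel_congr_of_chHead [Fintype E] {w : ℕ} {F : Type*} [Field F]
    {κ κ' : N.LocalPair w → F} {v : V}
    (hκ : ∀ p : N.LocalPair w, N.tail p.1.2 ≠ v → κ p = κ' p) (c : Channel E w)
    (hc : N.chHead c = v) : N.kernel κ c = N.kernel κ' c := by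
  rcases c with j | e
  · rfl
  · exact N.edgeKernel_congr hκ e fun h =>
      N.acyclic v (Relation.TransGen.tail' h ⟨e, rfl, hc⟩)

namespace DisjointPaths

variable {N} {w : ℕ} {t : V} (P : N.DisjointPaths w t)

/-! ### Channels along the paths -/

theorem chan_zero (j : Fin w) : P.chan j 0 = Sum.inl j := rfl

theorem chan_succ (j : Fin w) (n : ℕ) (hn : n < (P.path j).length) :
    P.chan j (n + 1) = Sum.inr (P.path j)[n] := by
  simp [chan, hn]

theorem length_pos (j : Fin w) : 0 < (P.path j).length :=
  List.length_pos_iff.2 (P.nonempty j)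

theorem tail_getElem (j : Fin w) (n : ℕ) (hn : n < (P.path j).length) :
    N.tail (P.path j)[n] = N.chHead (P.chan j n) := by
  cases n with
  | zero =>
    have h := P.tail_first j
    rw [List.head_eq_getElem] at h
    exact h
  | succ n =>
    rw [P.chan_succ j n (by omega)]
    exact (List.isChain_iff_getElem.1 (P.consecutive j) n hn).symm

theorem chHead_chan_length (j : Fin w) : N.chHead (P.chan j (P.path j).length) = t := by
  have h := P.head_last j
  have hl := P.length_pos j
  rw [List.getLast_eq_getElem] at h
  obtain ⟨m, hm⟩ : ∃ m, (P.path j).length = m + 1 := ⟨(P.path j).length - 1, by omega⟩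
  rw [hm, P.chan_succ j m (by omega)]
  simp only [hm, Nat.add_sub_cancel] at h
  exact h

theorem adj_chHead_chan (j : Fin w) (n : ℕ) (hn : n < (P.path j).length) :
    N.Adj (N.chHead (P.chan j n)) (N.chHead (P.chan j (n + 1))) :=
  ⟨(P.path j)[n], P.tail_getElem j n hn, by rw [P.chan_succ j n hn]; rfl⟩

theorem ancestor_source_chHead (j : Fin w) (n : ℕ) (hn : n < (P.path j).length) :
    N.Ancestor N.source (N.chHead (P.chan j (n + 1))) := by
  induction n with
  | zero => exact Relation.TransGen.single (P.adj_chHead_chan j 0 hn)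
  | succ n ih => exact (ih (by omega)).tail (P.adj_chHead_chan j (n + 1) hn)

/-- A nonempty path from the source to itself would be a cycle. The index `j` supplies a path, which
is missing when `w = 0`. -/
theorem source_ne_sink (P : N.DisjointPaths w t) (j : Fin w) : N.source ≠ t := by
  intro h
  have hl := P.length_pos j
  obtain ⟨m, hm⟩ : ∃ m, (P.path j).length = m + 1 := ⟨(P.path j).length - 1, by omega⟩
  have h1 := P.ancestor_source_chHead j m (by omega)
  rw [← hm, P.chHead_chan_length, ← h] at h1
  exact N.acyclic _ h1

/-- Channel-disjointness, extended to the imaginary channels; the bounds exclude the default value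
of `chan`. -/
theorem chan_inj {j j' : Fin w} {n n' : ℕ} (hn : n ≤ (P.path j).length)
    (hn' : n' ≤ (P.path j').length) (h : P.chan j n = P.chan j' n') : j = j' := by
  cases n with
  | zero =>
    cases n' with
    | zero => simpa [chan_zero] using h
    | succ n' => rw [chan_zero, P.chan_succ j' n' hn'] at h; cases h
  | succ n =>
    cases n' with
    | zero => rw [chan_zero, P.chan_succ j n hn] at h; cases h
    | succ n' =>
      rw [P.chan_succ j n hn, P.chan_succ j' n' hn'] at h
      have h' := Sum.inr.inj h
      by_contra hne
      exact P.disjoint j j' hne (List.getElem_mem hn) (h' ▸ List.getElem_mem hn')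

variable {P} {r : ℕ} {i : ℕ → V}

theorem IsAncestralOrder.mem_internalNodes (hi : P.IsAncestralOrder r i) {a : ℕ} (h1 : 1 ≤ a)
    (ha : a ≤ r) : i a ∈ P.internalNodes :=
  hi.image ▸ Set.mem_image_of_mem i ⟨h1, ha⟩

theorem IsAncestralOrder.ne_sink (hi : P.IsAncestralOrder r i) (j : Fin w) {a : ℕ} (ha : a ≤ r) :
    i a ≠ t := by
  rcases Nat.eq_zero_or_pos a with rfl | h
  · rw [hi.source]; exact P.source_ne_sink j
  · exact (hi.mem_internalNodes h ha).2.1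

theorem IsAncestralOrder.injective (hi : P.IsAncestralOrder r i) {a b : ℕ} (ha : a ≤ r)
    (hb : b ≤ r) (h : i a = i b) : a = b := by
  rcases Nat.eq_zero_or_pos a with rfl | ha' <;> rcases Nat.eq_zero_or_pos b with rfl | hb'
  · rfl
  · exact absurd (h ▸ hi.source) (hi.mem_internalNodes hb' hb).1
  · exact absurd (h ▸ hi.source) (hi.mem_internalNodes ha' ha).1
  · exact hi.injOn ⟨ha', ha⟩ ⟨hb', hb⟩ h

theorem IsAncestralOrder.exists_chHead_eq (hi : P.IsAncestralOrder r i) (j : Fin w) (n : ℕ)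
    (hn : n ≤ (P.path j).length) (ht : N.chHead (P.chan j n) ≠ t) :
    ∃ a ≤ r, N.chHead (P.chan j n) = i a := by
  by_cases hs : N.chHead (P.chan j n) = N.source
  · exact ⟨0, Nat.zero_le _, hs.trans hi.source.symm⟩
  · cases n with
    | zero => exact absurd rfl hs
    | succ n =>
      have hmem : N.chHead (P.chan j (n + 1)) ∈ P.internalNodes :=
        ⟨hs, ht, j, (P.path j)[n], List.getElem_mem hn, Or.inr (by rw [P.chan_succ j n hn]; rfl)⟩
      rw [← hi.image] at hmem
      obtain ⟨a, ha, h⟩ := hmem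
      exact ⟨a, ha.2, h.symm⟩

theorem lt_length_of_chHead_ne {j : Fin w} {n : ℕ} (hn : n ≤ (P.path j).length)
    (h : N.chHead (P.chan j n) ≠ t) : n < (P.path j).length :=
  lt_of_le_of_ne hn fun h' => h (h' ▸ P.chHead_chan_length j)

/-! ### The cuts -/

theorem cutPos_succ_of_eq {k : ℕ} {j : Fin w} (h : N.chHead (P.chan j (P.cutPos i k j)) = i k) :
    P.cutPos i (k + 1) j = P.cutPos i k j + 1 := if_pos h

theorem cutPos_succ_of_ne {k : ℕ} {j : Fin w} (h : N.chHead (P.chan j (P.cutPos i k j)) ≠ i k) :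
    P.cutPos i (k + 1) j = P.cutPos i k j := if_neg h

/-- The channels of the `k`-th cut start at one of `i_0, …, i_{k-1}` (or are imaginary), and
none of them ends at one of these nodes. -/
theorem IsAncestralOrder.cutPos_spec (hi : P.IsAncestralOrder r i) (j : Fin w) {k : ℕ}
    (hk : k ≤ r + 1) :
    P.cutPos i k j ≤ (P.path j).length ∧
      (∀ a < k, N.chHead (P.chan j (P.cutPos i k j)) ≠ i a) ∧
      ∀ e, P.chan j (P.cutPos i k j) = Sum.inr e → ∃ a < k, N.tail e = i a := by
  induction k with
  | zero =>
    refine ⟨Nat.zero_le _, fun a ha => absurd ha (Nat.not_lt_zero a), fun e he => ?_⟩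
    cases he
  | succ k ih =>
    obtain ⟨h1, h2, h3⟩ := ih (by omega)
    by_cases h : N.chHead (P.chan j (P.cutPos i k j)) = i k
    · have hlt : P.cutPos i k j < (P.path j).length :=
        lt_length_of_chHead_ne h1 (h ▸ hi.ne_sink j (by omega))
      rw [cutPos_succ_of_eq h]
      refine ⟨hlt, fun a ha h' => ?_, fun e he => ⟨k, Nat.lt_succ_self k, ?_⟩⟩
      -- A channel from `i_k` to `i_a` forces `k < a`, contrary to `a < k + 1`.
      · have hadj := P.adj_chHead_chan j _ hlt
        rw [h, h'] at hadj
        have := hi.ancestral k (by omega) a (by omega) (Relation.TransGen.single hadj)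
        omega
      · rw [P.chan_succ j _ hlt] at he
        rw [← Sum.inr.inj he, P.tail_getElem, h]
    · rw [cutPos_succ_of_ne h]
      refine ⟨h1, fun a ha => ?_, fun e he => ?_⟩
      · rcases Nat.lt_succ_iff_lt_or_eq.1 ha with ha | rfl
        · exact h2 a ha
        · exact h
      · obtain ⟨a, ha, h'⟩ := h3 e he
        exact ⟨a, by omega, h'⟩

theorem IsAncestralOrder.cutPos_le (hi : P.IsAncestralOrder r i) (j : Fin w) {k : ℕ}
    (hk : k ≤ r + 1) : P.cutPos i k j ≤ (P.path j).length := (hi.cutPos_spec j hk).1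

/-- Once `i_0, …, i_r` are excluded as heads, `t` is the only node left on the path. -/
theorem IsAncestralOrder.chHead_last_cut (hi : P.IsAncestralOrder r i) (j : Fin w) :
    N.chHead (P.chan j (P.cutPos i (r + 1) j)) = t := by
  obtain ⟨h1, h2, -⟩ := hi.cutPos_spec j le_rfl
  by_contra h
  obtain ⟨a, ha, h'⟩ := hi.exists_chHead_eq j _ h1 h
  exact h2 a (by omega) h'

/-- A real channel of the `k`-th cut leaves some `i_a` with `a < k`, and the ancestral order keeps
`i_k` from being upstream of it. -/
theorem IsAncestralOrder.kernel_cut_congr [Fintype E] {F : Type*} [Field F]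
    (hi : P.IsAncestralOrder r i) {κ κ' : N.LocalPair w → F} {k : ℕ} (hk : k ≤ r)
    (hκ : ∀ p : N.LocalPair w, N.tail p.1.2 ≠ i k → κ p = κ' p) (j : Fin w) :
    N.kernel κ (P.chan j (P.cutPos i k j)) = N.kernel κ' (P.chan j (P.cutPos i k j)) := by
  obtain ⟨-, -, h3⟩ := hi.cutPos_spec j (k := k) (by omega)
  rcases hc : P.chan j (P.cutPos i k j) with j' | e
  · rfl
  · obtain ⟨a, ha, h⟩ := h3 e hc
    refine N.edgeKernel_congr hκ e fun hr => ?_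
    rw [h] at hr
    rcases Relation.reflTransGen_iff_eq_or_transGen.1 hr with h' | h'
    · have := hi.injective (by omega) hk h'
      omega
    · have := hi.ancestral k hk a (by omega) h'
      omega

open Classical in
theorem IsAncestralOrder.card_cutOut [Fintype E] (hi : P.IsAncestralOrder r i) {k : ℕ}
    (hk : k ≤ r) :
    w - (P.cutOut i k).card =
      Fintype.card {j : Fin w // N.chHead (P.chan j (P.cutPos i k j)) = i k} := by
  have hout : P.cutOut i k = (Finset.univ.filter fun j : Fin w =>
      ¬ N.chHead (P.chan j (P.cutPos i k j)) = i k).image fun j => P.chan j (P.cutPos i k j) := by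
    ext c
    simp only [cutOut, cut, inChannels, Finset.mem_sdiff, Finset.mem_image, Finset.mem_univ,
      true_and, Finset.mem_filter]
    constructor
    · rintro ⟨⟨j, rfl⟩, h⟩
      exact ⟨j, h, rfl⟩
    · rintro ⟨j, h, rfl⟩
      exact ⟨⟨j, rfl⟩, h⟩
  rw [hout, Finset.card_image_of_injective _ fun j j' h =>
    P.chan_inj (hi.cutPos_le j (by omega)) (hi.cutPos_le j' (by omega)) h, Fintype.card_subtype]
  have := Finset.card_filter_add_card_filter_not (s := (Finset.univ : Finset (Fin w)))
    (p := fun j => N.chHead (P.chan j (P.cutPos i k j)) = i k)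
  simp only [Finset.card_univ, Fintype.card_fin] at this
  omega

end DisjointPaths
end Network

/-! ### Auxiliary sums and double counting -/

theorem Fintype.sum_dite_subtype {ι F : Type*} [Fintype ι] [AddCommMonoid F] (p : ι → Prop)
    [DecidablePred p] (f : {a // p a} → F) :
    ∑ a, (if h : p a then f ⟨a, h⟩ else 0) = ∑ a, f a := by
  rw [← Finset.sum_filter_of_ne (p := p) fun a _ h => by
    by_contra h'
    exact h (dif_neg h'), Finset.sum_subtype (p := p) _ (by simp)]
  exact Finset.sum_congr rfl fun a _ => dif_pos a.2

/-- Double counting along a family of translations: if every element of `S` is moved into `T` by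
at least `c` of them, then `c * #S` is at most the number of translations times `#T`. -/
theorem Finset.mul_card_le_of_translate {A B : Type*} [AddGroup A] [Fintype A] [DecidableEq A]
    [Fintype B] (s : B → A) (S T : Finset A) (c : ℝ)
    (h : ∀ κ ∈ S, c ≤ ((Finset.univ.filter fun M : B => κ + s M ∈ T).card : ℝ)) :
    c * S.card ≤ Fintype.card B * T.card := by
  have htrans : ∀ M : B, (Finset.univ.filter fun κ : A => κ + s M ∈ T).card = T.card := fun M =>
    Finset.card_equiv (Equiv.addRight (s M)) fun κ => by simp
  have hdouble : ∑ κ : A, (Finset.univ.filter fun M : B => κ + s M ∈ T).card =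
      ∑ M : B, (Finset.univ.filter fun κ : A => κ + s M ∈ T).card := by
    simp only [Finset.card_filter]
    exact Finset.sum_comm
  rw [Finset.sum_congr rfl fun M _ => htrans M, Finset.sum_const, Finset.card_univ,
    smul_eq_mul] at hdouble
  calc c * S.card = ∑ κ ∈ S, c := by rw [Finset.sum_const, nsmul_eq_mul, mul_comm]
    _ ≤ ∑ κ ∈ S, ((Finset.univ.filter fun M : B => κ + s M ∈ T).card : ℝ) := Finset.sum_le_sum h
    _ ≤ ∑ κ : A, ((Finset.univ.filter fun M : B => κ + s M ∈ T).card : ℝ) :=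
        Finset.sum_le_sum_of_subset_of_nonneg (Finset.subset_univ _) fun _ _ _ =>
          Nat.cast_nonneg _
    _ = _ := by
        rw [← Nat.cast_sum, hdouble]
        push_cast
        ring

theorem Matrix.card_square {m F : Type*} [Fintype m] [DecidableEq m] [Fintype F] :
    Fintype.card (Matrix m m F) = Fintype.card F ^ (Fintype.card m * Fintype.card m) := by
  rw [pow_mul]
  exact (Fintype.card_fun (α := m) (β := m → F)).trans (by rw [Fintype.card_fun])

/-! ### Modifying a block of an invertible matrix -/

/-- The extension by zero of a square matrix indexed by a subtype. -/
def Matrix.extendZero {m F : Type*} [Zero F] (p : m → Prop) [DecidablePred p]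
    (M : Matrix {a // p a} {a // p a} F) : Matrix m m F :=
  Matrix.of fun a b => if ha : p a then if hb : p b then M ⟨a, ha⟩ ⟨b, hb⟩ else 0 else 0

/-- With `B` factored out, the columns outside `p` are those of the identity. The other factor is
thus block triangular, and `M` only affects its `p`-block. -/
theorem Matrix.det_add_mul_extendZero_ne_zero {m F : Type*} [Fintype m] [DecidableEq m] [Field F]
    (p : m → Prop) [DecidablePred p] (B B' : Matrix m m F) (hB : B.det ≠ 0)
    (hcol : ∀ a b, ¬ p b → B' a b = B a b) (M : Matrix {a // p a} {a // p a} F)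
    (hM : (Matrix.toSquareBlockProp (B⁻¹ * B') p + M).det ≠ 0) :
    (B' + B * Matrix.extendZero p M).det ≠ 0 := by
  have hu : IsUnit B.det := isUnit_iff_ne_zero.2 hB
  have hD : B' + B * Matrix.extendZero p M = B * (B⁻¹ * B' + Matrix.extendZero p M) := by
    rw [mul_add, Matrix.mul_nonsing_inv_cancel_left _ _ hu]
  have hinv : ∀ a b, ¬ p b → (B⁻¹ * B') a b = (1 : Matrix m m F) a b := by
    intro a b hb
    rw [← Matrix.nonsing_inv_mul B hu, Matrix.mul_apply, Matrix.mul_apply]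
    exact Finset.sum_congr rfl fun c _ => by rw [hcol c b hb]
  have hentry : ∀ a b, ¬ p b →
      (B⁻¹ * B' + Matrix.extendZero p M) a b = (1 : Matrix m m F) a b := by
    intro a b hb
    simp [Matrix.extendZero, hinv a b hb, hb]
  rw [hD, Matrix.det_mul, Matrix.twoBlockTriangular_det'
    (B⁻¹ * B' + Matrix.extendZero p M) p fun a ha b hb => by
    rw [hentry a b hb, Matrix.one_apply_ne (by rintro rfl; exact hb ha)]]
  refine mul_ne_zero hB (mul_ne_zero ?_ ?_)
  · convert hM using 2
    ext a b
    simp [Matrix.toSquareBlockProp, Matrix.extendZero, a.2, b.2]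
  · have : Matrix.toSquareBlockProp (B⁻¹ * B' + Matrix.extendZero p M) (fun a => ¬ p a) = 1 := by
      ext a b
      rw [Matrix.toSquareBlockProp, Matrix.toBlock_apply, hentry _ _ b.2]
      simp [Matrix.one_apply, Subtype.ext_iff]
    rw [this, Matrix.det_one]
    exact one_ne_zero

/-! ### Cut matrices and shifts of the coefficients -/

namespace Network.DisjointPaths

variable {V E : Type*} {N : Network V E} {w : ℕ} {t : V}

/-- The paths whose channel in the `k`-th cut enters `i_k`. -/
abbrev Entering (P : N.DisjointPaths w t) (i : ℕ → V) (k : ℕ) (j : Fin w) : Prop :=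
  N.chHead (P.chan j (P.cutPos i k j)) = i k

/-- The matrix of the global encoding kernels of the channels of the `k`-th cut. -/
noncomputable def cutMatrix [Fintype E] {F : Type*} [Field F] (P : N.DisjointPaths w t)
    (i : ℕ → V) (k : ℕ) (κ : N.LocalPair w → F) : Matrix (Fin w) (Fin w) F :=
  Matrix.of fun a j => N.kernel κ (P.chan j (P.cutPos i k j)) a

open Classical in
/-- The coefficients that are `M` on the pairs consisting of a channel of the `k`-th cut
entering `i_k` and of the successor of such a channel, and zero on all other pairs. -/
noncomputable def shift {F : Type*} [Field F] (P : N.DisjointPaths w t) (i : ℕ → V) (k : ℕ)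
    (M : Matrix {j // P.Entering i k j} {j // P.Entering i k j} F) (p : N.LocalPair w) : F :=
  ∑ j', ∑ j, if p.1.1 = P.chan j'.1 (P.cutPos i k j'.1) ∧
    Sum.inr p.1.2 = P.chan j.1 (P.cutPos i k j.1 + 1) then M j' j else 0

variable {P : N.DisjointPaths w t} {r : ℕ} {i : ℕ → V}

theorem IsAncestralOrder.lt_length_of_entering (hi : P.IsAncestralOrder r i) {k : ℕ} (hk : k ≤ r)
    {j : Fin w} (hj : P.Entering i k j) : P.cutPos i k j < (P.path j).length :=
  lt_length_of_chHead_ne (hi.cutPos_le j (by omega)) (hj ▸ hi.ne_sink j hk)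

theorem IsAncestralOrder.shift_eq_zero {F : Type*} [Field F] (hi : P.IsAncestralOrder r i)
    {k : ℕ} (hk : k ≤ r) (M : Matrix {j // P.Entering i k j} {j // P.Entering i k j} F)
    (p : N.LocalPair w) (hp : N.tail p.1.2 ≠ i k) : P.shift i k M p = 0 := by
  refine Finset.sum_eq_zero fun j' _ => Finset.sum_eq_zero fun j _ => if_neg ?_
  rintro ⟨-, h⟩
  have hlt := hi.lt_length_of_entering hk j.2
  rw [P.chan_succ _ _ hlt] at h
  rw [Sum.inr.inj h, P.tail_getElem _ _ hlt] at hp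
  exact hp j.2

variable [Fintype E] {F : Type*} [Field F]

open Classical in
/-- The effect of a shift on the successors of the channels of the cut entering `i_k`. -/
theorem IsAncestralOrder.kernel_add_shift (hi : P.IsAncestralOrder r i) {k : ℕ} (hk : k ≤ r)
    (κ : N.LocalPair w → F) (M : Matrix {j // P.Entering i k j} {j // P.Entering i k j} F)
    (j : {j // P.Entering i k j}) :
    N.kernel (κ + P.shift i k M) (P.chan j.1 (P.cutPos i k j.1 + 1)) =
      N.kernel κ (P.chan j.1 (P.cutPos i k j.1 + 1)) +
        ∑ j', M j' j • N.kernel κ (P.chan j'.1 (P.cutPos i k j'.1)) := by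
  have hlt := hi.lt_length_of_entering hk j.2
  have hκ : ∀ p : N.LocalPair w, N.tail p.1.2 ≠ i k → (κ + P.shift i k M) p = κ p := by
    intro p hp
    rw [Pi.add_apply, hi.shift_eq_zero hk M p hp, add_zero]
  have htail : N.tail (P.path j.1)[P.cutPos i k j.1] = i k := by
    rw [P.tail_getElem _ _ hlt]; exact j.2
  have hshift : ∀ d : {d : Channel E w // N.chHead d = N.tail (P.path j.1)[P.cutPos i k j.1]},
      P.shift i k M ⟨(d.1, (P.path j.1)[P.cutPos i k j.1]), d.2⟩ =
        ∑ j', if d.1 = P.chan j'.1 (P.cutPos i k j'.1) then M j' j else 0 := by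
    intro d
    refine Finset.sum_congr rfl fun j' _ => ?_
    -- Successors on different paths are different channels, so only the column `j` of `M`
    -- contributes.
    rw [Finset.sum_eq_single j]
    · simp [← P.chan_succ _ _ hlt]
    · intro j₁ _ hne
      refine if_neg fun h => hne ?_
      rw [← P.chan_succ _ _ hlt] at h
      exact (Subtype.ext (P.chan_inj hlt (hi.lt_length_of_entering hk j₁.2) h.2)).symm
    · simp
  rw [P.chan_succ _ _ hlt, kernel_inr, kernel_inr]
  have hd : ∀ d : {d : Channel E w // N.chHead d = N.tail (P.path j.1)[P.cutPos i k j.1]},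
      N.kernel (κ + P.shift i k M) d.1 = N.kernel κ d.1 := fun d =>
    N.kernel_congr_of_chHead hκ d.1 (d.2.trans htail)
  simp only [hd, Pi.add_apply, add_smul, Finset.sum_add_distrib, hshift, Finset.sum_smul]
  congr 1
  rw [Finset.sum_comm]
  refine Finset.sum_congr rfl fun j' _ => ?_
  rw [Finset.sum_eq_single ⟨P.chan j'.1 (P.cutPos i k j'.1), j'.2.trans htail.symm⟩]
  · simp
  · intro d _ hne
    rw [if_neg fun h => hne (Subtype.ext h), zero_smul]
  · simp

open Classical in
-- The shift lives on coefficients at `i_k`, so kernels already in the `k`-th cut stay fixed, and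
-- each new kernel gains a combination of the entering ones.
theorem IsAncestralOrder.cutMatrix_succ_add_shift (hi : P.IsAncestralOrder r i) {k : ℕ}
    (hk : k ≤ r) (κ : N.LocalPair w → F)
    (M : Matrix {j // P.Entering i k j} {j // P.Entering i k j} F) :
    P.cutMatrix i (k + 1) (κ + P.shift i k M) =
      P.cutMatrix i (k + 1) κ + P.cutMatrix i k κ * Matrix.extendZero (P.Entering i k) M := by
  ext a j
  rw [Matrix.add_apply, Matrix.mul_apply]
  simp only [cutMatrix, Matrix.of_apply, Matrix.extendZero]
  by_cases hj : P.Entering i k j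
  · rw [cutPos_succ_of_eq hj, hi.kernel_add_shift hk κ M ⟨j, hj⟩, Pi.add_apply, Finset.sum_apply]
    congr 1
    rw [← Fintype.sum_dite_subtype (P.Entering i k) fun j' =>
      (M j' ⟨j, hj⟩ • N.kernel κ (P.chan j'.1 (P.cutPos i k j'.1))) a]
    refine Finset.sum_congr rfl fun j' _ => ?_
    by_cases hj' : P.Entering i k j'
    · simp only [dif_pos hj', dif_pos hj, Pi.smul_apply, smul_eq_mul, mul_comm]
    · simp only [dif_neg hj', mul_zero]
  · rw [cutPos_succ_of_ne hj, hi.kernel_cut_congr hk (κ' := κ)]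
    · simp [hj]
    · intro p hp
      rw [Pi.add_apply, hi.shift_eq_zero hk M p hp, add_zero]

open Classical in
/-- Among the coefficients for which the `k`-th cut carries full rank, the proportion of those
for which the next cut does is bounded below. -/
theorem IsAncestralOrder.card_cutMatrix_succ [Fintype F] (hi : P.IsAncestralOrder r i) {k : ℕ}
    (hk : k ≤ r) :
    (∏ h ∈ Finset.Icc 1 (w - (P.cutOut i k).card), (1 - 1 / (Fintype.card F : ℝ) ^ h)) *
        ((Finset.univ.filter fun κ : N.LocalPair w → F => (P.cutMatrix i k κ).det ≠ 0).card : ℝ) ≤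
      (Finset.univ.filter fun κ : N.LocalPair w → F =>
        (P.cutMatrix i (k + 1) κ).det ≠ 0).card := by
  rw [hi.card_cutOut hk]
  set S := Finset.univ.filter fun κ : N.LocalPair w → F => (P.cutMatrix i k κ).det ≠ 0
  set T := Finset.univ.filter fun κ : N.LocalPair w → F => (P.cutMatrix i (k + 1) κ).det ≠ 0
  have hq : (0 : ℝ) < (Fintype.card F : ℝ) ^
      (Fintype.card {j // P.Entering i k j} * Fintype.card {j // P.Entering i k j}) :=
    pow_pos (by exact_mod_cast Fintype.card_pos) _
  have hlow : ∀ κ ∈ S, (∏ h ∈ Finset.Icc 1 (Fintype.card {j // P.Entering i k j}),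
          (1 - 1 / (Fintype.card F : ℝ) ^ h)) *
        (Fintype.card F : ℝ) ^
          (Fintype.card {j // P.Entering i k j} * Fintype.card {j // P.Entering i k j}) ≤
      ((Finset.univ.filter fun M : Matrix {j // P.Entering i k j} {j // P.Entering i k j} F =>
        κ + P.shift i k M ∈ T).card : ℝ) := by
    intro κ hκ
    rw [← card_det_add_ne_zero
      (Matrix.toSquareBlockProp ((P.cutMatrix i k κ)⁻¹ * P.cutMatrix i (k + 1) κ)
        (P.Entering i k))]
    refine Nat.cast_le.2 (Finset.card_le_card fun M hM => ?_)
    simp only [Finset.mem_filter, Finset.mem_univ, true_and, S, T] at hM hκ ⊢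
    rw [hi.cutMatrix_succ_add_shift hk]
    refine Matrix.det_add_mul_extendZero_ne_zero _ _ _ hκ (fun a j hj => ?_) _ hM
    simp only [cutMatrix, Matrix.of_apply]
    rw [cutPos_succ_of_ne hj]
  have hcardM : Fintype.card (Matrix {j // P.Entering i k j} {j // P.Entering i k j} F) =
      Fintype.card F ^ (Fintype.card {j // P.Entering i k j} * Fintype.card {j // P.Entering i k j}) :=
    Matrix.card_square
  -- There are `q^(m²)` translations, which cancels the same power in `hlow`.
  have hle := Finset.mul_card_le_of_translate (P.shift i k) S T _ hlow
  rw [hcardM, Nat.cast_pow] at hle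
  refine le_of_mul_le_mul_left ?_ hq
  linarith

open Classical in
theorem IsAncestralOrder.prod_le_card_cutMatrix [Fintype F] (hi : P.IsAncestralOrder r i) {k : ℕ}
    (hk : k ≤ r + 1) :
    (∏ k ∈ Finset.range k, ∏ h ∈ Finset.Icc 1 (w - (P.cutOut i k).card),
        (1 - 1 / (Fintype.card F : ℝ) ^ h)) * (Fintype.card (N.LocalPair w → F) : ℝ) ≤
      (Finset.univ.filter fun κ : N.LocalPair w → F => (P.cutMatrix i k κ).det ≠ 0).card := by
  induction k with
  | zero =>
    have hone : ∀ κ : N.LocalPair w → F, P.cutMatrix i 0 κ = 1 := by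
      intro κ
      ext a j
      simp [cutMatrix, cutPos, chan_zero, kernel, Matrix.one_apply, Pi.single_apply]
    simp [hone]
  | succ k ih =>
    refine le_trans ?_ (hi.card_cutMatrix_succ (F := F) (k := k) (by omega))
    rw [Finset.prod_range_succ, mul_comm (∏ k ∈ Finset.range k, _), mul_assoc]
    refine mul_le_mul_of_nonneg_left (ih (by omega)) (Finset.prod_nonneg fun h _ => ?_)
    have hq : (1 : ℝ) ≤ (Fintype.card F : ℝ) ^ h :=
      one_le_pow₀ (by exact_mod_cast Fintype.card_pos)
    rw [sub_nonneg, div_le_one (by linarith)]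
    exact hq

/-- If the last cut carries full rank, then the sink can decode. -/
theorem IsAncestralOrder.le_rank_decodingMatrix (hi : P.IsAncestralOrder r i)
    (κ : N.LocalPair w → F) (h : (P.cutMatrix i (r + 1) κ).det ≠ 0) :
    w ≤ (N.decodingMatrix κ t).rank := by
  classical
  let g : Fin w → N.inChannels w t := fun j =>
    ⟨P.chan j (P.cutPos i (r + 1) j), by simp [inChannels, hi.chHead_last_cut j]⟩
  -- The 0/1 factor selects the last cut's columns among all columns of the decoding matrix.
  have hmul : P.cutMatrix i (r + 1) κ =
      N.decodingMatrix κ t * Matrix.of fun c j => if c = g j then (1 : F) else 0 := by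
    ext a j
    simp [Matrix.mul_apply, cutMatrix, decodingMatrix, g]
  have hr := Matrix.rank_of_isUnit _ ((Matrix.isUnit_iff_isUnit_det _).2 (isUnit_iff_ne_zero.2 h))
  rw [Fintype.card_fin] at hr
  calc w = (P.cutMatrix i (r + 1) κ).rank := hr.symm
    _ ≤ _ := by rw [hmul]; exact Matrix.rank_mul_le_left _ _

end Network.DisjointPaths

/-! ### The bound on the failure probability -/

theorem theorem7 {V E F Ω : Type*} [Fintype V] [Fintype E] [Field F] [Fintype F]
    [MeasurableSpace F] [MeasurableSingletonClass F]
    [MeasurableSpace Ω] (μ : Measure Ω) [IsProbabilityMeasure μ]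
    (N : Network V E) (w : ℕ) (t : V)
    (K : N.LocalPair w → Ω → F) (hK : N.IsRandomCoding μ K)
    (P : N.DisjointPaths w t) (r : ℕ) (i : ℕ → V) (hi : P.IsAncestralOrder r i) :
    N.failureProb μ K t ≤
      1 - ∏ k ∈ Finset.range (r + 1), ∏ h ∈ Finset.Icc 1 (w - (P.cutOut i k).card),
        (1 - 1 / (Fintype.card F : ℝ) ^ h) := by
  classical
  set S := Finset.univ.filter fun κ : N.LocalPair w → F => (P.cutMatrix i (r + 1) κ).det ≠ 0
  have hN : (0 : ℝ) < Fintype.card (N.LocalPair w → F) := by exact_mod_cast Fintype.card_pos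
  have hS := hi.prod_le_card_cutMatrix (F := F) le_rfl
  have hcompl : (Sᶜ.card : ℝ) = Fintype.card (N.LocalPair w → F) - S.card := by
    rw [Finset.card_compl, Nat.cast_sub (Finset.card_le_univ _)]
  -- Failure forces the last cut matrix to be singular; the converse may fail, as `t` may have
  -- further incoming channels.
  calc N.failureProb μ K t ≤ μ.real {ω | (fun p => K p ω) ∈ Sᶜ} := by
        refine measureReal_mono fun ω hω => ?_
        simp only [Set.mem_ofPred_eq, Finset.mem_compl] at hω ⊢
        intro h
        exact absurd (hi.le_rank_decodingMatrix _ (Finset.mem_filter.1 h).2) (not_le.2 hω)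
    _ = Sᶜ.card / (Fintype.card (N.LocalPair w → F) : ℝ) :=
        measureReal_eq_card_div μ K hK.measurable hK.indep hK.uniform Sᶜ
    _ ≤ _ := by
        rw [hcompl, sub_div, div_self hN.ne']
        exact sub_le_sub_left ((le_div_iff₀ hN).2 hS) 1
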